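/- Let $\mathbb H^1$ be the Heisenberg group, that is $\mathbb R^3$ with coordinates $(x,y,z)$, the left-invariant vector fields $X=\partial_x-\frac y2\partial_z$, $Y=\partial_y+\frac x2\partial_z$, the contact form $\omega=dz-\frac12(x\,dy-y\,dx)$ and the Lebesgue measure. For a smooth real $1$-form $A$ on $\mathbb H^1$ let $-\Delta_A$ be the operator in $L^2(\mathbb H^1)$ associated with the closure of the quadratic form $$Q_A(u)=\int_{\mathbb H^1}\Big(|(X+iA(X))u|^2+|(Y+iA(Y))u|^2\Big)\,dx\,dy\,dz,\qquad u\in C_c^\infty(\mathbb H^1).$$ **Theorem 2.1.** There is a universal constant $c>0$ such that the following holds. Let $b=(b_1,b_2)\in\mathbb R^2$, let $B=b_1\,dx\wedge\omega+b_2\,dy\wedge\omega$ and $|B|=\sqrt{b_1^2+b_2^2}$, and let $A$ be any smooth real $1$-form on $\mathbb H^1$ that is a vector potential of $B$ modulo $\omega$, that is, $d(A+f\omega)=B$ for some smooth real function $f$ (in particular, any $A$ with $dA=B$). Then the spectrum of $-\Delta_A$ in $L^2(\mathbb H^1)$ is real and $$\inf\sigma(-\Delta_A)=c\,|B|^{2/3}.$$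 -/

import Mathlib

open MeasureTheory Filter Topology
open scoped ContDiff Distributions

noncomputable section

namespace HeisenbergMagnetic

/-! ### The Heisenberg group and differential forms on it -/

/-- The manifold underlying the Heisenberg group `ℍ¹`, with coordinates `q = (x, y, z)`
(`x = q.1`, `y = q.2.1`, `z = q.2.2`). The Haar measure is the Lebesgue measure `volume`. -/
abbrev Heis : Type := ℝ × ℝ × ℝ

/-- The horizontal left-invariant vector field `X = ∂_x - (y/2) ∂_z`. -/
def fieldX (q : Heis) : Heis := (1, 0, -q.2.1 / 2)

/-- The horizontal left-invariant vector field `Y = ∂_y + (x/2) ∂_z`. -/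
def fieldY (q : Heis) : Heis := (0, 1, q.1 / 2)

/-- The covector `dx`. -/
def formDx : Heis →L[ℝ] ℝ := ContinuousLinearMap.fst ℝ ℝ (ℝ × ℝ)

/-- The covector `dy`. -/
def formDy : Heis →L[ℝ] ℝ :=
  (ContinuousLinearMap.fst ℝ ℝ ℝ).comp (ContinuousLinearMap.snd ℝ ℝ (ℝ × ℝ))

/-- The covector `dz`. -/
def formDz : Heis →L[ℝ] ℝ :=
  (ContinuousLinearMap.snd ℝ ℝ ℝ).comp (ContinuousLinearMap.snd ℝ ℝ (ℝ × ℝ))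

/-- The contact form `ω = dz - (x dy - y dx) / 2`. -/
def contactForm (q : Heis) : Heis →L[ℝ] ℝ :=
  formDz - (1 / 2 : ℝ) • (q.1 • formDy - q.2.1 • formDx)

/-- A smooth real differential `1`-form on `ℍ¹ = ℝ³`. -/
structure OneForm where
  /-- The underlying covector field. -/
  toFun : Heis → Heis →L[ℝ] ℝ
  smooth : ContDiff ℝ ∞ toFun

/-- The exterior derivative of a `1`-form, a `2`-form. -/
def extD (A : Heis → Heis →L[ℝ] ℝ) (q : Heis) : Heis [⋀^Fin 2]→L[ℝ] ℝ :=
  extDeriv (fun p => ContinuousAlternatingMap.ofSubsingleton ℝ Heis ℝ (0 : Fin 1) (A p)) q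

/-- The wedge product `α ∧ β` of two covectors. -/
def wedge (α β : Heis →L[ℝ] ℝ) : Heis [⋀^Fin 2]→L[ℝ] ℝ :=
  ContinuousAlternatingMap.alternatizeUncurryFin
    (α.smulRight (ContinuousAlternatingMap.ofSubsingleton ℝ Heis ℝ (0 : Fin 1) β))

theorem wedge_apply (α β : Heis →L[ℝ] ℝ) (v w : Heis) :
    wedge α β ![v, w] = α v * β w - α w * β v := by
  simp [wedge, ContinuousAlternatingMap.alternatizeUncurryFin_apply, Fin.sum_univ_two,
    Fin.removeNth, sub_eq_add_neg]

theorem extD_apply {A : Heis → Heis →L[ℝ] ℝ} {q : Heis} (h : DifferentiableAt ℝ A q)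
    (v w : Heis) : extD A q ![v, w] = fderiv ℝ A q v w - fderiv ℝ A q w v := by
  have h1 : HasFDerivAt (fun p => ContinuousAlternatingMap.ofSubsingleton ℝ Heis ℝ (0 : Fin 1)
      (A p)) _ q :=
    ((ContinuousAlternatingMap.ofSubsingletonLIE (𝕜 := ℝ) (E := Heis) (F := ℝ)
      (0 : Fin 1)).toContinuousLinearEquiv.toContinuousLinearMap.hasFDerivAt).comp q
      h.hasFDerivAt
  simp [extD, extDeriv, h1.fderiv, ContinuousAlternatingMap.alternatizeUncurryFin_apply,
    Fin.sum_univ_two, Fin.removeNth, sub_eq_add_neg]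

/-- The uniform horizontal magnetic field `B = b₁ dx ∧ ω + b₂ dy ∧ ω`. -/
def uniformField (b₁ b₂ : ℝ) (q : Heis) : Heis [⋀^Fin 2]→L[ℝ] ℝ :=
  b₁ • wedge formDx (contactForm q) + b₂ • wedge formDy (contactForm q)

/-- `A` is a vector potential of the `2`-form `B`. Vector potentials are considered modulo the
contact form: for some smooth function `f`, the `1`-form `A + f ω` is a primitive of `B`. If `B` is
horizontal, this says that `D A = B` for the Rumin differential `D`; it contains the
case `d A = B`, where `f = 0`. -/
def IsVectorPotential (A : OneForm) (B : Heis → Heis [⋀^Fin 2]→L[ℝ] ℝ) : Prop :=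
  ∃ f : Heis → ℝ, ContDiff ℝ ∞ f ∧ ∀ q, extD (fun p => A.toFun p + f p • contactForm p) q = B q

/-! ### The magnetic form on test functions -/

/-- The Hilbert space `L²(ℍ¹)` of complex-valued functions. -/
abbrev L2 : Type := Lp ℂ 2 (volume : Measure Heis)

/-- The space `C_c^∞(ℍ¹)` of complex-valued test functions. -/
abbrev Test : Type := 𝓓((⊤ : TopologicalSpace.Opens Heis), ℂ)

/-- The magnetic derivative `(V + i A(V)) u` along a vector field `V`. -/
def magDeriv (A : OneForm) (V : Heis → Heis) (u : Heis → ℂ) (q : Heis) : ℂ :=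
  fderiv ℝ u q (V q) + Complex.I * (A.toFun q (V q) : ℂ) * u q

/-- The sesquilinear form on test functions, conjugate-linear in `φ`, whose quadratic form is
`Q_A(u) = ∫ |(d_H + i A) u|² = ∫ (|(X + i A(X)) u|² + |(Y + i A(Y)) u|²)`. -/
def magForm (A : OneForm) (φ ψ : Test) : ℂ :=
  ∫ q : Heis, (starRingEnd ℂ (magDeriv A fieldX φ q) * magDeriv A fieldX ψ q
    + starRingEnd ℂ (magDeriv A fieldY φ q) * magDeriv A fieldY ψ q)

theorem test_memLp (φ : Test) : MemLp φ 2 (volume : Measure Heis) :=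
  φ.continuous.memLp_of_hasCompactSupport φ.hasCompactSupport

/-- A test function as an element of `L²(ℍ¹)`. -/
def toL2 : Test →ₗ[ℂ] L2 where
  toFun φ := (test_memLp φ).toLp φ
  map_add' _ _ := rfl
  map_smul' _ _ := rfl

theorem continuous_fieldX : Continuous fieldX := by unfold fieldX; fun_prop

theorem continuous_fieldY : Continuous fieldY := by unfold fieldY; fun_prop

theorem continuous_magDeriv (A : OneForm) {V : Heis → Heis} (hV : Continuous V) (φ : Test) :
    Continuous (magDeriv A V φ) := by
  have h1 : Continuous (fderiv ℝ φ) := φ.contDiff.continuous_fderiv (by simp)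
  have h2 : Continuous A.toFun := A.smooth.continuous
  have h3 : Continuous φ := φ.continuous
  unfold magDeriv
  have h4 : Continuous fun q => A.toFun q (V q) := h2.clm_apply hV
  exact (h1.clm_apply hV).add
    ((continuous_const.mul (Complex.continuous_ofReal.comp h4)).mul h3)

theorem hasCompactSupport_magDeriv (A : OneForm) (V : Heis → Heis) (φ : Test) :
    HasCompactSupport (magDeriv A V φ) := by
  have h1 : HasCompactSupport (fderiv ℝ φ) := φ.hasCompactSupport.fderiv ℝ
  refine HasCompactSupport.add ?_ (φ.hasCompactSupport.mul_left)
  exact h1.mono' fun q hq => subset_tsupport _ fun h => hq (by simp [h])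

theorem memLp_magDeriv (A : OneForm) {V : Heis → Heis} (hV : Continuous V) (φ : Test) :
    MemLp (magDeriv A V φ) 2 (volume : Measure Heis) :=
  (continuous_magDeriv A hV φ).memLp_of_hasCompactSupport (hasCompactSupport_magDeriv A V φ)

/-- The magnetic derivative as a linear map from test functions to `L²(ℍ¹)`. -/
def magDerivL2 (A : OneForm) {V : Heis → Heis} (hV : Continuous V) : Test →ₗ[ℂ] L2 where
  toFun φ := (memLp_magDeriv A hV φ).toLp (magDeriv A V φ)
  map_add' φ ψ := by
    rw [← MemLp.toLp_add]
    congr 1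
    ext q
    have h1 := (φ.contDiff.differentiable (by simp)) q
    have h2 := (ψ.contDiff.differentiable (by simp)) q
    simp only [magDeriv, FunLike.coe_add, fderiv_add h1 h2, Pi.add_apply,
      add_apply]
    ring
  map_smul' c φ := by
    rw [RingHom.id_apply, ← MemLp.toLp_const_smul]
    congr 1
    ext q
    have h1 := (φ.contDiff.differentiable (by simp)) q
    simp only [magDeriv, FunLike.coe_smul, fderiv_const_smul h1, Pi.smul_apply,
      smul_apply, smul_eq_mul]
    ring

theorem magForm_eq_inner (A : OneForm) (φ ψ : Test) :
    magForm A φ ψ =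
      inner ℂ (magDerivL2 A continuous_fieldX φ) (magDerivL2 A continuous_fieldX ψ)
      + inner ℂ (magDerivL2 A continuous_fieldY φ) (magDerivL2 A continuous_fieldY ψ) := by
  rw [L2.inner_def, L2.inner_def, ← integral_add (L2.integrable_inner _ _)
    (L2.integrable_inner _ _), magForm]
  refine integral_congr_ae ?_
  filter_upwards [(memLp_magDeriv A continuous_fieldX φ).coeFn_toLp,
    (memLp_magDeriv A continuous_fieldX ψ).coeFn_toLp,
    (memLp_magDeriv A continuous_fieldY φ).coeFn_toLp,
    (memLp_magDeriv A continuous_fieldY ψ).coeFn_toLp] with q h1 h2 h3 h4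
  simp only [magDerivL2, LinearMap.coe_mk, AddHom.coe_mk, h1, h2, h3, h4, RCLike.inner_apply]
  ring

/-! ### The closure of the form, and the associated operator -/

/-- `φ` is a sequence of test functions that converges to `u` in the sense of the form `Q_A`:
`φ n → u` in `L²` and `Q_A (φ m - φ n) → 0` as `m, n → ∞`. The domain of the closure of `Q_A`
consists of the `u` for which there is such a sequence, and the closure takes the
value `lim Q_A (ψ n, φ n)` at `(v, u)` if `ψ` and `φ` converge so to `v` and `u`. -/
structure FormConverges (A : OneForm) (φ : ℕ → Test) (u : L2) : Prop where
  tendsto : Tendsto (fun n => toL2 (φ n)) atTop (𝓝 u)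
  cauchy : Tendsto (fun p : ℕ × ℕ => magForm A (φ p.1 - φ p.2) (φ p.1 - φ p.2)) atTop (𝓝 0)

theorem formConverges_iff (A : OneForm) (φ : ℕ → Test) (u : L2) :
    FormConverges A φ u ↔ Tendsto (fun n => toL2 (φ n)) atTop (𝓝 u) ∧
      CauchySeq (fun n => magDerivL2 A continuous_fieldX (φ n)) ∧
      CauchySeq (fun n => magDerivL2 A continuous_fieldY (φ n)) := by
  have key : ∀ a b : L2, inner ℂ a a + inner ℂ b b = ((‖a‖ ^ 2 + ‖b‖ ^ 2 : ℝ) : ℂ) := by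
    intro a b
    rw [inner_self_eq_norm_sq_to_K, inner_self_eq_norm_sq_to_K]
    push_cast
    rfl
  have hC : ∀ F : ℕ → L2, CauchySeq F ↔
      Tendsto (fun p : ℕ × ℕ => ‖F p.1 - F p.2‖ ^ 2) atTop (𝓝 0) := by
    intro F
    rw [cauchySeq_iff_tendsto_dist_atTop_0]
    simp only [dist_eq_norm]
    constructor
    · intro h
      simpa using h.pow 2
    · intro h
      simpa using h.sqrt
  have hmain : Tendsto (fun p : ℕ × ℕ => magForm A (φ p.1 - φ p.2) (φ p.1 - φ p.2)) atTop (𝓝 0) ↔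
      CauchySeq (fun n => magDerivL2 A continuous_fieldX (φ n)) ∧
      CauchySeq (fun n => magDerivL2 A continuous_fieldY (φ n)) := by
    simp only [magForm_eq_inner, key, hC, map_sub]
    rw [← Complex.ofReal_zero, tendsto_ofReal_iff]
    constructor
    · intro h
      exact ⟨squeeze_zero (fun _ => by positivity)
        (fun p => le_add_of_nonneg_right (by positivity)) h,
        squeeze_zero (fun _ => by positivity)
        (fun p => le_add_of_nonneg_left (by positivity)) h⟩
    · rintro ⟨h1, h2⟩
      simpa using h1.add h2
  exact ⟨fun h => ⟨h.tendsto, hmain.1 h.cauchy⟩, fun h => ⟨h.1, hmain.2 h.2⟩⟩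

theorem FormConverges.add {A : OneForm} {φ ψ : ℕ → Test} {u v : L2} (hφ : FormConverges A φ u)
    (hψ : FormConverges A ψ v) : FormConverges A (φ + ψ) (u + v) := by
  rw [formConverges_iff] at *
  simp only [Pi.add_apply, map_add]
  exact ⟨hφ.1.add hψ.1, hφ.2.1.add hψ.2.1, hφ.2.2.add hψ.2.2⟩

theorem FormConverges.smul {A : OneForm} {φ : ℕ → Test} {u : L2} (c : ℂ)
    (hφ : FormConverges A φ u) : FormConverges A (c • φ) (c • u) := by
  rw [formConverges_iff] at *
  simp only [Pi.smul_apply, map_smul]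
  exact ⟨hφ.1.const_smul c, hφ.2.1.map (uniformContinuous_const_smul c),
    hφ.2.2.map (uniformContinuous_const_smul c)⟩

theorem formConverges_const (A : OneForm) (φ : Test) :
    FormConverges A (fun _ => φ) (toL2 φ) := by
  rw [formConverges_iff]
  exact ⟨tendsto_const_nhds, cauchySeq_const _, cauchySeq_const _⟩

/-- The graph of the operator associated with the closure `q` of the form `Q_A`: the pairs `(u, f)`
such that `u` lies in the domain of `q` and `q (v, u) = ⟪v, f⟫` for all `v` in the domain of `q`. -/
def laplacianGraph (A : OneForm) : Submodule ℂ (L2 × L2) where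
  carrier := {p | ∃ φ : ℕ → Test, FormConverges A φ p.1 ∧
    ∀ (v : L2) (ψ : ℕ → Test), FormConverges A ψ v →
      Tendsto (fun n => magForm A (ψ n) (φ n)) atTop (𝓝 (inner ℂ v p.2))}
  add_mem' := by
    rintro ⟨u, f⟩ ⟨u', f'⟩ ⟨φ, h1, h2⟩ ⟨φ', h1', h2'⟩
    refine ⟨φ + φ', h1.add h1', fun v ψ hψ => ?_⟩
    have := (h2 v ψ hψ).add (h2' v ψ hψ)
    simp only [magForm_eq_inner, Pi.add_apply, map_add, inner_add_right, Prod.snd_add] at *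
    refine this.congr fun n => ?_
    ring
  zero_mem' := by
    refine ⟨fun _ => 0, by simpa using formConverges_const A 0, fun v ψ _ => ?_⟩
    simp [magForm_eq_inner]
  smul_mem' := by
    rintro c ⟨u, f⟩ ⟨φ, h1, h2⟩
    refine ⟨c • φ, h1.smul c, fun v ψ hψ => ?_⟩
    have := (h2 v ψ hψ).const_mul c
    simp only [magForm_eq_inner, Pi.smul_apply, map_smul, inner_smul_right, Prod.smul_snd] at *
    refine this.congr fun n => ?_
    ring

theorem dense_range_toL2 : DenseRange toL2 := by
  refine (Lp.dense_hasCompactSupport_contDiff (F := ℂ) (μ := (volume : Measure Heis))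
    (p := 2) (by simp)).mono ?_
  rintro f ⟨g, hfg, hg, hg'⟩
  let φ : Test := ⟨g, hg', hg, fun _ _ => trivial⟩
  refine ⟨φ, Lp.ext ?_⟩
  exact ((test_memLp φ).coeFn_toLp).trans hfg.symm

/-- The associated operator is single-valued, as the test functions are dense. -/
theorem laplacianGraph_singleValued (A : OneForm) :
    ∀ p ∈ laplacianGraph A, p.1 = 0 → p.2 = 0 := by
  rintro ⟨u, f⟩ ⟨φ, h1, h2⟩ rfl
  obtain ⟨hu, hX, hY⟩ := (formConverges_iff A φ 0).1 h1
  obtain ⟨gX, hgX⟩ := cauchySeq_tendsto_of_complete hX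
  obtain ⟨gY, hgY⟩ := cauchySeq_tendsto_of_complete hY
  have h3 := h2 0 φ h1
  simp only [magForm_eq_inner, inner_zero_left] at h3
  have h4 := tendsto_nhds_unique h3 ((hgX.inner hgX).add (hgY.inner hgY))
  rw [inner_self_eq_norm_sq_to_K, inner_self_eq_norm_sq_to_K] at h4
  have h5 : (0 : ℝ) = ‖gX‖ ^ 2 + ‖gY‖ ^ 2 := by
    apply Complex.ofReal_injective
    push_cast
    exact h4
  have h6 : gX = 0 := norm_eq_zero.1 (by nlinarith [norm_nonneg gX, sq_nonneg ‖gY‖])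
  have h7 : gY = 0 := norm_eq_zero.1 (by nlinarith [norm_nonneg gY, sq_nonneg ‖gX‖])
  subst h6 h7
  refine dense_range_toL2.eq_zero_of_inner_right ℂ ?_
  intro ψ
  have h8 := h2 (toL2 ψ) _ (formConverges_const A ψ)
  simp only [magForm_eq_inner] at h8
  have h9 := tendsto_nhds_unique h8
    ((tendsto_const_nhds.inner hgX).add (tendsto_const_nhds.inner hgY))
  simpa using h9

/-- The magnetic sub-Laplacian `-Δ_A`: the unbounded operator in `L²(ℍ¹)` associated with the
closure of the form `Q_A` on `C_c^∞(ℍ¹)`. -/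
def magLaplacian (A : OneForm) : L2 →ₗ.[ℂ] L2 := (laplacianGraph A).toLinearPMap

theorem magLaplacian_graph (A : OneForm) : (magLaplacian A).graph = laplacianGraph A :=
  Submodule.toLinearPMap_graph_eq _ (laplacianGraph_singleValued A)

/-! ### The spectrum of an unbounded operator -/

/-- The spectrum of an unbounded operator `T` in a Hilbert space: the complement of the
resolvent set, which consists of the `z` such that `T - z` is a bijection of the domain of `T` onto
the space with a bounded inverse `R`. -/
def spectrumOf {H : Type*} [NormedAddCommGroup H] [InnerProductSpace ℂ H] (T : H →ₗ.[ℂ] H) :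
    Set ℂ :=
  {z | ∃ R : H →L[ℂ] H, (∀ u : T.domain, R (T u - z • (u : H)) = u) ∧
    ∀ f : H, ∃ u : T.domain, (u : H) = R f ∧ T u - z • (u : H) = f}ᶜ

end HeisenbergMagnetic

end

/-! Completing the test functions in the form norm gives a Hilbert space with a contraction J to L².
By Riesz representation, `J J*` is the inverse of -Δ_A + 1: it is bounded, positive and nonzero. The
spectrum of -Δ_A is therefore real with minimum ‖J‖⁻² - 1, which is also the best lower bound of the
quadratic form (`spectrumOf_magLaplacian`, `formBottom_isGreatest`). What remains concerns lower
bounds of Q_A on test functions only.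

These bounds depend only on the field. Two potentials of one field, corrected by multiples of ω,
differ by a closed, hence exact, form dθ. As ω vanishes on X and Y, multiplication by exp(-iθ)
intertwines the two forms (`FormBound.of_gauge`). The automorphism acting horizontally as a complex
number w and centrally as |w|² multiplies Q by |w|² relative to the L² norm, rotates the field and
multiplies its length by |w|³ (`FormBound.scale`). Hence every nonzero field reduces to dx ∧ ω, with
exponent 2/3, and c is the bottom for dx ∧ ω.

Positivity of c is an uncertainty principle. For the potential (x²/2) dy, the iterated commutator
[X, [X, Y + i x²/2]] is the scalar i. In group form, a product of unit-time unitary flows equals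
exp(i) times another such product (`transX_transY_commutator`). If both magnetic derivatives of φ
were small in L², both products would almost fix φ, which is impossible because exp(i) ≠ 1
(`eLpNorm_le_magDeriv`). An explicit lower bound results, with no need for an eigenfunction or a
spectral decomposition. -/

noncomputable section

namespace HeisenbergMagnetic

/-! ### Spectrum of an operator given through its resolvent at `-1` -/

section Resolvent

variable {H : Type*} [NormedAddCommGroup H] [InnerProductSpace ℂ H]

/-- If `R` is the inverse of `T + 1`, then `z` is in the spectrum of `T` if and only if
`1 - (1 + z) R` is not invertible. -/
theorem mem_spectrumOf_iff {T : H →ₗ.[ℂ] H} {R : H →L[ℂ] H}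
    (hT : ∀ u f, (u, f) ∈ T.graph ↔ u = R (f + u)) (z : ℂ) :
    z ∈ spectrumOf T ↔ ¬ IsUnit (1 - (1 + z) • R) := by
  -- Adding (1 + z) u turns (T - z) u = f into (T + 1) u = f + (1 + z) u; then R is applied.
  have hdom : ∀ u f, (∃ v : T.domain, (v : H) = u ∧ T v - z • (v : H) = f) ↔
      (1 - (1 + z) • R) u = R f := by
    intro u f
    have h1 : (∃ v : T.domain, (v : H) = u ∧ T v - z • (v : H) = f) ↔
        (u, f + z • u) ∈ T.graph := by
      rw [LinearPMap.mem_graph_iff]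
      refine exists_congr fun v => and_congr_right fun hv => ?_
      subst hv
      exact sub_eq_iff_eq_add
    rw [h1, hT]
    have h2 : R (f + z • u + u) = R f + (1 + z) • R u := by
      simp only [map_add, map_smul, add_smul, one_smul]
      abel
    rw [h2]
    exact sub_eq_iff_eq_add.symm
  rw [spectrumOf, Set.mem_compl_iff, not_iff_not, Set.mem_ofPred_eq]
  constructor
  · rintro ⟨S, hS1, hS2⟩
    have hMS : (1 - (1 + z) • R) * S = R := by
      ext f
      obtain ⟨u, hu, huf⟩ := hS2 f
      exact (hdom _ _).1 ⟨u, hu, huf⟩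
    have hSM : S * (1 - (1 + z) • R) = R := by
      ext g
      have hg : (R g, g - R g) ∈ T.graph := (hT _ _).2 (by simp)
      obtain ⟨u, hu, huf⟩ := (LinearPMap.mem_graph_iff T).1 hg
      have h := hS1 u
      have hu' : (u : H) = R g := hu
      have huf' : T u = g - R g := huf
      rw [hu', huf'] at h
      rw [← h]
      change S (g - (1 + z) • R g) = _
      rw [add_smul, one_smul, sub_sub]
    -- By the resolvent identity, if S inverts T - z, then 1 + (1 + z) S inverts 1 - (1 + z) R.
    refine ⟨⟨_, 1 + (1 + z) • S, ?_, ?_⟩, rfl⟩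
    · rw [mul_add, mul_one, mul_smul_comm, hMS, sub_add_cancel]
    · rw [add_mul, one_mul, smul_mul_assoc, hSM, sub_add_cancel]
  · rintro ⟨M, hM⟩
    have h1 : ∀ u, (↑M⁻¹ : H →L[ℂ] H) ((1 - (1 + z) • R) u) = u := by
      intro u
      rw [← hM]
      exact congrArg (fun L : H →L[ℂ] H => L u) M.inv_mul
    have h2 : ∀ u, (1 - (1 + z) • R) ((↑M⁻¹ : H →L[ℂ] H) u) = u := by
      intro u
      rw [← hM]
      exact congrArg (fun L : H →L[ℂ] H => L u) M.mul_inv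
    refine ⟨(↑M⁻¹ : H →L[ℂ] H) * R, fun u => ?_, fun f => ?_⟩
    · have h := (hdom u (T u - z • (u : H))).1 ⟨u, rfl, rfl⟩
      change (↑M⁻¹ : H →L[ℂ] H) (R _) = _
      rw [← h, h1]
    · exact (hdom _ _).2 (h2 _)

/-- If the inverse `R` of `T + 1` is a nonzero positive bounded operator, then the spectrum of `T`
is real with least element `‖R‖⁻¹ - 1`. -/
theorem spectrumOf_real_and_isLeast [CompleteSpace H] {T : H →ₗ.[ℂ] H} {R : H →L[ℂ] H}
    (hT : ∀ u f, (u, f) ∈ T.graph ↔ u = R (f + u)) (hR : R.IsPositive) (hR0 : R ≠ 0) :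
    spectrumOf T ⊆ Set.range Complex.ofReal ∧
      IsLeast {s : ℝ | (s : ℂ) ∈ spectrumOf T} (‖R‖⁻¹ - 1) := by
  have hn : 0 < ‖R‖ := norm_pos_iff.2 hR0
  have hnt : Nontrivial (H →L[ℂ] H) := ⟨R, 0, hR0⟩
  have hR' : 0 ≤ R := (ContinuousLinearMap.nonneg_iff_isPositive R).2 hR
  have key : ∀ z ∈ spectrumOf T, ∃ s : ℝ, (s : ℂ) = z ∧ ‖R‖⁻¹ - 1 ≤ s := by
    intro z hz
    -- Spectral mapping: z is in the spectrum of T only if (1 + z)⁻¹ is in that of R, which lies in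
    -- [0, ‖R‖]; the value z = -1 is excluded since 1 is invertible.
    rw [mem_spectrumOf_iff hT] at hz
    have hz1 : 1 + z ≠ 0 := by
      rintro h
      simp [h] at hz
    have hmem : (1 + z)⁻¹ ∈ spectrum ℂ R := by
      rw [spectrum.mem_iff]
      intro hu
      apply hz
      have h1 : 1 - (1 + z) • R =
          (Units.mk0 (1 + z) hz1) • (algebraMap ℂ (H →L[ℂ] H) (1 + z)⁻¹ - R) := by
        rw [Units.smul_def, Units.val_mk0, smul_sub, Algebra.algebraMap_eq_smul_one, smul_smul,
          mul_inv_cancel₀ hz1, one_smul]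
      rw [h1]
      exact hu.smul _
    have hre := hR.isSelfAdjoint.mem_spectrum_eq_re hmem
    set r := ((1 + z)⁻¹).re with hr
    have hrR : r ∈ spectrum ℝ R := by
      rw [← spectrum.algebraMap_mem_iff ℂ]
      rwa [hre] at hmem
    have hr0 : 0 ≤ r := spectrum_nonneg_of_nonneg hR' hrR
    have hr1 : r ≠ 0 := by
      intro h0
      rw [h0] at hre
      exact inv_ne_zero hz1 (by simpa using hre)
    have hr2 : r ≤ ‖R‖ := (le_abs_self r).trans (spectrum.norm_le_norm_of_mem hrR)
    refine ⟨r⁻¹ - 1, ?_, ?_⟩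
    · push_cast
      rw [← hre, inv_inv]
      ring
    · have := inv_anti₀ (lt_of_le_of_ne hr0 hr1.symm) hr2
      linarith
  refine ⟨fun z hz => ?_, ?_, fun s hs => ?_⟩
  · obtain ⟨s, hs, -⟩ := key z hz
    exact ⟨s, hs⟩
  · rw [Set.mem_ofPred_eq, mem_spectrumOf_iff hT]
    intro hu
    -- The bound is attained because the norm of a positive operator belongs to its spectrum.
    have h1 : ‖R‖ ∈ spectrum ℝ R := CStarAlgebra.norm_mem_spectrum_of_nonneg hR'
    rw [← spectrum.algebraMap_mem_iff ℂ, spectrum.mem_iff] at h1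
    apply h1
    have hc : ((‖R‖ : ℝ) : ℂ) ≠ 0 := by exact_mod_cast hn.ne'
    have h2 : algebraMap ℂ (H →L[ℂ] H) (algebraMap ℝ ℂ ‖R‖) - R =
        (Units.mk0 _ hc) • (1 - (1 + ((‖R‖⁻¹ - 1 : ℝ) : ℂ)) • R) := by
      rw [Units.smul_def, Units.val_mk0, smul_sub, smul_smul, Algebra.algebraMap_eq_smul_one]
      have : ((‖R‖ : ℝ) : ℂ) * (1 + ((‖R‖⁻¹ - 1 : ℝ) : ℂ)) = 1 := by
        push_cast
        field_simp
        ring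
      rw [this, one_smul]
      rfl
    rw [h2]
    exact hu.smul _
  · obtain ⟨s', hs', h⟩ := key _ hs
    rwa [Complex.ofReal_injective hs'] at h

end Resolvent

/-! ### The energy space -/

/-- A test function together with its magnetic derivatives. -/
def energyMap (A : OneForm) : Test →ₗ[ℂ] PiLp 2 (fun _ : Fin 3 => L2) :=
  (WithLp.linearEquiv 2 ℂ (Fin 3 → L2)).symm.toLinearMap ∘ₗ
    LinearMap.pi ![toL2, magDerivL2 A continuous_fieldX, magDerivL2 A continuous_fieldY]

@[simp] theorem energyMap_zero (A : OneForm) (φ : Test) : energyMap A φ 0 = toL2 φ := rfl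

@[simp] theorem energyMap_one (A : OneForm) (φ : Test) :
    energyMap A φ 1 = magDerivL2 A continuous_fieldX φ := rfl

@[simp] theorem energyMap_two (A : OneForm) (φ : Test) :
    energyMap A φ 2 = magDerivL2 A continuous_fieldY φ := rfl

theorem magForm_eq_inner_energyMap (A : OneForm) (φ ψ : Test) :
    magForm A φ ψ = inner ℂ (energyMap A φ) (energyMap A ψ) - inner ℂ (toL2 φ) (toL2 ψ) := by
  rw [magForm_eq_inner, PiLp.inner_apply, Fin.sum_univ_three]
  simp only [energyMap_zero, energyMap_one, energyMap_two]
  ring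

/-- The completion of the test functions in the form norm. -/
def energySpace (A : OneForm) : Submodule ℂ (PiLp 2 (fun _ : Fin 3 => L2)) :=
  (LinearMap.range (energyMap A)).topologicalClosure

instance (A : OneForm) : CompleteSpace (energySpace A) :=
  (Submodule.isClosed_topologicalClosure _).completeSpace_coe

theorem energyMap_mem (A : OneForm) (φ : Test) : energyMap A φ ∈ energySpace A :=
  Submodule.le_topologicalClosure _ ⟨φ, rfl⟩

/-- The projection of the energy space to `L²`. -/
def energyToL2 (A : OneForm) : energySpace A →L[ℂ] L2 :=
  (PiLp.proj 2 (fun _ : Fin 3 => L2) (0 : Fin 3)).comp (energySpace A).subtypeL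

/-- The inverse of `-Δ_A + 1`. -/
def resolvent (A : OneForm) : L2 →L[ℂ] L2 :=
  (energyToL2 A).comp (ContinuousLinearMap.adjoint (energyToL2 A))

theorem resolvent_isPositive (A : OneForm) : (resolvent A).IsPositive :=
  ContinuousLinearMap.isPositive_self_comp_adjoint _

theorem norm_resolvent (A : OneForm) : ‖resolvent A‖ = ‖energyToL2 A‖ ^ 2 := by
  have h := ContinuousLinearMap.norm_adjoint_comp_self (ContinuousLinearMap.adjoint (energyToL2 A))
  rw [ContinuousLinearMap.adjoint_adjoint, LinearIsometryEquiv.norm_map] at h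
  rw [resolvent, h, sq]

/-- By completeness, the two Cauchy conditions amount to convergence of the whole triple. The limit
w is not required to be determined by u, so closability of the form plays no role. -/
theorem formConverges_iff_energyMap (A : OneForm) (φ : ℕ → Test) (u : L2) :
    FormConverges A φ u ↔ ∃ w : energySpace A, energyToL2 A w = u ∧
      Tendsto (fun n => energyMap A (φ n)) atTop (𝓝 (w : PiLp 2 (fun _ : Fin 3 => L2))) := by
  rw [formConverges_iff]
  constructor
  · rintro ⟨hu, hX, hY⟩
    obtain ⟨gX, hgX⟩ := cauchySeq_tendsto_of_complete hX
    obtain ⟨gY, hgY⟩ := cauchySeq_tendsto_of_complete hY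
    have ht : Tendsto (fun n => energyMap A (φ n)) atTop (𝓝 (WithLp.toLp 2 ![u, gX, gY])) := by
      refine ((PiLp.continuous_toLp 2 (fun _ : Fin 3 => L2)).tendsto ![u, gX, gY]).comp
        (g := WithLp.toLp 2) (f := fun n => (energyMap A (φ n)).ofLp) ?_
      rw [tendsto_pi_nhds]
      intro i
      fin_cases i
      · exact hu
      · exact hgX
      · exact hgY
    exact ⟨⟨_, mem_closure_of_tendsto ht (Eventually.of_forall fun n => ⟨φ n, rfl⟩)⟩, rfl, ht⟩
  · rintro ⟨w, rfl, h⟩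
    have h' : ∀ i : Fin 3, Tendsto (fun n => energyMap A (φ n) i) atTop
        (𝓝 ((w : PiLp 2 (fun _ : Fin 3 => L2)) i)) := fun i =>
      ((PiLp.proj (𝕜 := ℂ) 2 (fun _ : Fin 3 => L2) i).continuous.tendsto _).comp h
    exact ⟨h' 0, (h' 1).cauchySeq, (h' 2).cauchySeq⟩

theorem exists_formConverges (A : OneForm) (w : energySpace A) :
    ∃ φ : ℕ → Test, FormConverges A φ (energyToL2 A w) ∧
      Tendsto (fun n => energyMap A (φ n)) atTop (𝓝 (w : PiLp 2 (fun _ : Fin 3 => L2))) := by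
  obtain ⟨x, hx, hxw⟩ := mem_closure_iff_seq_limit.1 w.2
  choose φ hφ using hx
  have h : Tendsto (fun n => energyMap A (φ n)) atTop
      (𝓝 (w : PiLp 2 (fun _ : Fin 3 => L2))) := by simpa only [hφ] using hxw
  exact ⟨φ, (formConverges_iff_energyMap A φ _).2 ⟨w, rfl, h⟩, h⟩

/-- Adding ⟪v, u⟫ to the weak equation q(v, u) = ⟪v, f⟫ turns its left side into the energy inner
product. It then says that the limit w satisfies ⟪v, w⟫ = ⟪J v, f + u⟫ for all v, that is w = J*(f +
u), and u = J w. -/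
theorem mem_laplacianGraph_iff (A : OneForm) (u f : L2) :
    (u, f) ∈ laplacianGraph A ↔ u = resolvent A (f + u) := by
  constructor
  · rintro ⟨φ, h1, h2⟩
    obtain ⟨w, hwu, hw⟩ := (formConverges_iff_energyMap A φ u).1 h1
    have hw' : w = ContinuousLinearMap.adjoint (energyToL2 A) (f + u) := by
      refine ext_inner_left ℂ fun v => ?_
      rw [ContinuousLinearMap.adjoint_inner_right]
      obtain ⟨ψ, hψ, hψv⟩ := exists_formConverges A v
      have h3 := h2 _ ψ hψ
      simp only [magForm_eq_inner_energyMap] at h3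
      have h4 := tendsto_nhds_unique h3 ((hψv.inner hw).sub (hψ.tendsto.inner h1.tendsto))
      dsimp only at h4
      rw [inner_add_right, h4, sub_add_cancel]
      rfl
    rw [resolvent, ContinuousLinearMap.comp_apply, ← hw', hwu]
  · intro hu
    obtain ⟨φ, h1, h2⟩ := exists_formConverges A
      (ContinuousLinearMap.adjoint (energyToL2 A) (f + u))
    have hu' : energyToL2 A (ContinuousLinearMap.adjoint (energyToL2 A) (f + u)) = u := hu.symm
    rw [hu'] at h1
    refine ⟨φ, h1, fun v ψ hψ => ?_⟩
    obtain ⟨w, hwv, hw⟩ := (formConverges_iff_energyMap A ψ v).1 hψ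
    simp only [magForm_eq_inner_energyMap]
    have h3 := (hw.inner (𝕜 := ℂ) h2).sub (hψ.tendsto.inner h1.tendsto)
    convert h3 using 2
    rw [← Submodule.coe_inner, ContinuousLinearMap.adjoint_inner_right, hwv, inner_add_right,
      add_sub_cancel_right]

theorem resolvent_ne_zero (A : OneForm) : resolvent A ≠ 0 := by
  intro h
  have h0 : ‖energyToL2 A‖ = 0 := by
    have := norm_resolvent A
    rw [h, norm_zero] at this
    exact (pow_eq_zero_iff two_ne_zero).1 this.symm
  have h1 : ∀ φ : Test, toL2 φ = 0 := fun φ => by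
    have := (energyToL2 A).le_opNorm ⟨_, energyMap_mem A φ⟩
    rw [h0, zero_mul] at this
    exact norm_le_zero_iff.1 this
  have h2 : ∀ f : L2, f = 0 := by
    intro f
    refine dense_range_toL2.eq_zero_of_inner_right ℂ fun φ => ?_
    rw [h1, inner_zero_left]
  have h3 := h2 (indicatorConstLp 2 (measurableSet_ball (x := (0 : Heis)) (ε := 1))
    measure_ball_lt_top.ne 1)
  have h4 := congrArg norm h3
  rw [norm_indicatorConstLp (by simp) (by simp), norm_one, one_mul, norm_zero] at h4
  have h5 : 0 < (volume : Measure Heis).real (Metric.ball 0 1) :=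
    ENNReal.toReal_pos (Metric.measure_ball_pos volume _ one_pos).ne' measure_ball_lt_top.ne
  exact (Real.rpow_pos_of_pos h5 _).ne' h4

/-! ### The bottom of the form -/

/-- The form `Q_A` is bounded below by `m`. -/
def FormBound (A : OneForm) (m : ℝ) : Prop :=
  ∀ φ : Test, m * ∫ q, ‖φ q‖ ^ 2 ≤
    ∫ q, (‖magDeriv A fieldX φ q‖ ^ 2 + ‖magDeriv A fieldY φ q‖ ^ 2)

theorem norm_toLp_sq {f : Heis → ℂ} (hf : MemLp f 2 volume) :
    ‖hf.toLp f‖ ^ 2 = ∫ q, ‖f q‖ ^ 2 := by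
  rw [← @inner_self_eq_norm_sq ℂ, L2.inner_def]
  have : ∫ q, inner ℂ (hf.toLp f q) (hf.toLp f q) = ((∫ q, ‖f q‖ ^ 2 : ℝ) : ℂ) := by
    rw [← integral_complex_ofReal]
    refine integral_congr_ae ?_
    filter_upwards [hf.coeFn_toLp] with q hq
    rw [hq, inner_self_eq_norm_sq_to_K]
    push_cast
    rfl
  rw [this]
  exact Complex.ofReal_re _

/-- The squared energy norm is Q_A plus the squared L² norm, so m becomes 1 + m. -/
theorem formBound_iff (A : OneForm) (m : ℝ) :
    FormBound A m ↔ ∀ φ : Test, (1 + m) * ‖toL2 φ‖ ^ 2 ≤ ‖energyMap A φ‖ ^ 2 := by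
  refine forall_congr' fun φ => ?_
  have h0 : ‖toL2 φ‖ ^ 2 = ∫ q, ‖φ q‖ ^ 2 := norm_toLp_sq (test_memLp φ)
  have hX : ‖magDerivL2 A continuous_fieldX φ‖ ^ 2 = ∫ q, ‖magDeriv A fieldX φ q‖ ^ 2 :=
    norm_toLp_sq (memLp_magDeriv A continuous_fieldX φ)
  have hY : ‖magDerivL2 A continuous_fieldY φ‖ ^ 2 = ∫ q, ‖magDeriv A fieldY φ q‖ ^ 2 :=
    norm_toLp_sq (memLp_magDeriv A continuous_fieldY φ)
  rw [integral_add ((memLp_magDeriv A continuous_fieldX φ).integrable_norm_pow two_ne_zero)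
    ((memLp_magDeriv A continuous_fieldY φ).integrable_norm_pow two_ne_zero), ← h0, ← hX, ← hY,
    PiLp.norm_sq_eq_of_L2, Fin.sum_univ_three, energyMap_zero, energyMap_one, energyMap_two]
  constructor <;> intro h <;> linarith

/-- The bottom of the form `Q_A`. -/
def formBottom (A : OneForm) : ℝ := ‖resolvent A‖⁻¹ - 1

/-- The best constant in (1 + m) ‖J w‖² ≤ ‖w‖² is 1 + m = ‖J‖⁻² = ‖R‖⁻¹; by density it suffices to
test the images of test functions. -/
theorem formBottom_isGreatest (A : OneForm) : IsGreatest {m | FormBound A m} (formBottom A) := by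
  have hpos : 0 < ‖resolvent A‖ := norm_pos_iff.2 (resolvent_ne_zero A)
  constructor
  · rw [Set.mem_ofPred_eq, formBound_iff]
    intro φ
    have h := (energyToL2 A).le_opNorm ⟨_, energyMap_mem A φ⟩
    have h2 : ‖toL2 φ‖ ^ 2 ≤ ‖resolvent A‖ * ‖energyMap A φ‖ ^ 2 := by
      rw [norm_resolvent, ← mul_pow]
      exact pow_le_pow_left₀ (norm_nonneg _) h 2
    rw [formBottom, add_sub_cancel, inv_mul_le_iff₀ hpos]
    exact h2
  · intro m hm
    rw [Set.mem_ofPred_eq, formBound_iff] at hm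
    -- Here the claim is trivial, since ‖R‖⁻¹ - 1 > -1; otherwise one may divide by 1 + m.
    by_cases hm1 : 1 + m ≤ 0
    · have := inv_pos.2 hpos
      rw [formBottom]
      linarith
    push Not at hm1
    have hw : ∀ w : energySpace A, (1 + m) * ‖energyToL2 A w‖ ^ 2 ≤ ‖w‖ ^ 2 := by
      intro w
      obtain ⟨φ, h1, h2⟩ := exists_formConverges A w
      exact le_of_tendsto_of_tendsto' ((h1.tendsto.norm.pow 2).const_mul (1 + m))
        (h2.norm.pow 2) fun n => hm (φ n)
    have hJ : ‖energyToL2 A‖ ≤ Real.sqrt (1 + m)⁻¹ := by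
      refine ContinuousLinearMap.opNorm_le_bound _ (Real.sqrt_nonneg _) fun w => ?_
      refine le_of_sq_le_sq ?_ (by positivity)
      rw [mul_pow, Real.sq_sqrt (by positivity), ← div_eq_inv_mul, le_div_iff₀' hm1]
      exact hw w
    have hR : ‖resolvent A‖ ≤ (1 + m)⁻¹ := by
      rw [norm_resolvent, ← Real.sq_sqrt (inv_nonneg.2 hm1.le)]
      gcongr
    have := inv_anti₀ hpos hR
    rw [inv_inv] at this
    rw [formBottom]
    linarith

/-- The spectrum of `-Δ_A` is real, and its least element is the bottom of the form `Q_A`. -/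
theorem spectrumOf_magLaplacian (A : OneForm) :
    spectrumOf (magLaplacian A) ⊆ Set.range Complex.ofReal ∧
      IsLeast {s : ℝ | (s : ℂ) ∈ spectrumOf (magLaplacian A)} (formBottom A) :=
  spectrumOf_real_and_isLeast (fun u f => by rw [magLaplacian_graph, mem_laplacianGraph_iff])
    (resolvent_isPositive A) (resolvent_ne_zero A)

/-! ### Gauge invariance -/

@[simp] theorem formDx_apply (v : Heis) : formDx v = v.1 := rfl

@[simp] theorem formDy_apply (v : Heis) : formDy v = v.2.1 := rfl

@[simp] theorem formDz_apply (v : Heis) : formDz v = v.2.2 := rfl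

@[simp] theorem contactForm_apply (q v : Heis) :
    contactForm q v = v.2.2 - (q.1 * v.2.1 - q.2.1 * v.1) / 2 := by
  simp [contactForm]
  ring

theorem contactForm_fieldX (q : Heis) : contactForm q (fieldX q) = 0 := by
  simp [fieldX]

theorem contactForm_fieldY (q : Heis) : contactForm q (fieldY q) = 0 := by
  simp [fieldY]

theorem contDiff_contactForm : ContDiff ℝ ∞ contactForm := by
  unfold contactForm
  fun_prop

theorem uniformField_apply (b₁ b₂ : ℝ) (q v w : Heis) :
    uniformField b₁ b₂ q ![v, w] =
      b₁ * (v.1 * contactForm q w - w.1 * contactForm q v) +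
        b₂ * (v.2.1 * contactForm q w - w.2.1 * contactForm q v) := by
  change b₁ * wedge formDx (contactForm q) ![v, w] + b₂ * wedge formDy (contactForm q) ![v, w] = _
  rw [wedge_apply, wedge_apply]
  rfl

theorem twoForm_ext {α β : Heis [⋀^Fin 2]→L[ℝ] ℝ} (h : ∀ v w, α ![v, w] = β ![v, w]) : α = β := by
  ext v
  have hv : v = ![v 0, v 1] := by
    ext i : 1
    fin_cases i <;> rfl
  rw [hv]
  exact h _ _

/-- A smooth closed `1`-form on `ℍ¹` is exact. -/
theorem exists_primitive {C : Heis → Heis →L[ℝ] ℝ} (hC : ContDiff ℝ ∞ C)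
    (h : ∀ q, extD C q = 0) : ∃ θ : Heis → ℝ, ContDiff ℝ ∞ θ ∧ ∀ q, HasFDerivAt θ (C q) q := by
  have hd : Differentiable ℝ C := hC.differentiable (by simp)
  -- Poincaré lemma: closedness of C is the symmetry of its derivative.
  obtain ⟨θ, hθ⟩ := convex_univ.exists_forall_hasFDerivAt_of_fderiv_symmetric isOpen_univ
    hd.differentiableOn fun a _ x y => by
      have h1 := extD_apply (hd a) x y
      rw [h] at h1
      exact (sub_eq_zero.1 h1.symm)
  have hθ' : ∀ q, HasFDerivAt θ (C q) q := fun q => hθ q trivial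
  refine ⟨θ, contDiff_infty_iff_fderiv.2 ⟨fun q => (hθ' q).differentiableAt, ?_⟩, hθ'⟩
  rwa [funext fun q => (hθ' q).fderiv]

/-- Two vector potentials of the same field differ by an exact form on the horizontal fields. -/
theorem IsVectorPotential.exists_gauge {A A' : OneForm} {B : Heis → Heis [⋀^Fin 2]→L[ℝ] ℝ}
    (h : IsVectorPotential A B) (h' : IsVectorPotential A' B) :
    ∃ θ : Heis → ℝ, ContDiff ℝ ∞ θ ∧ ∀ q v, contactForm q v = 0 →
      A.toFun q v = A'.toFun q v + fderiv ℝ θ q v := by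
  obtain ⟨f, hf, hfB⟩ := h
  obtain ⟨f', hf', hfB'⟩ := h'
  have hs : ContDiff ℝ ∞ fun p => A.toFun p + f p • contactForm p :=
    A.smooth.add (hf.smul contDiff_contactForm)
  have hs' : ContDiff ℝ ∞ fun p => A'.toFun p + f' p • contactForm p :=
    A'.smooth.add (hf'.smul contDiff_contactForm)
  obtain ⟨θ, hθ, hθ'⟩ := exists_primitive (hs.sub hs') fun q => by
    have hd := (hs.differentiable (by simp)) q
    have hd' := (hs'.differentiable (by simp)) q
    refine twoForm_ext fun v w => ?_
    rw [extD_apply (hd.fun_sub hd'), fderiv_fun_sub hd hd']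
    have h1 := extD_apply hd v w
    have h2 := extD_apply hd' v w
    rw [hfB] at h1
    rw [hfB'] at h2
    simp only [sub_apply]
    change _ = (0 : ℝ)
    linarith
  refine ⟨θ, hθ, fun q v hv => ?_⟩
  rw [(hθ' q).fderiv]
  simp [-contactForm_apply, hv]

/-- The test function with given underlying function. -/
def mkTest (u : Heis → ℂ) (h : ContDiff ℝ ∞ u) (h' : HasCompactSupport u) : Test :=
  ⟨u, h, h', fun _ _ => trivial⟩

theorem magDeriv_gauge {A A' : OneForm} {θ : Heis → ℝ} {u : Heis → ℂ} {V : Heis → Heis} {q : Heis}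
    (hθ : DifferentiableAt ℝ θ q) (hu : DifferentiableAt ℝ u q)
    (h : A.toFun q (V q) = A'.toFun q (V q) + fderiv ℝ θ q (V q)) :
    magDeriv A V (fun p => Complex.exp (-(Complex.I * θ p)) * u p) q =
      Complex.exp (-(Complex.I * θ q)) * magDeriv A' V u q := by
  have h1 : HasFDerivAt (fun p => ((θ p : ℝ) : ℂ)) (Complex.ofRealCLM.comp (fderiv ℝ θ q)) q :=
    Complex.ofRealCLM.hasFDerivAt.comp q hθ.hasFDerivAt
  have h2 := (((h1.const_mul Complex.I).fun_neg).cexp).fun_mul hu.hasFDerivAt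
  unfold magDeriv
  rw [h, HasFDerivAt.fderiv h2]
  simp
  ring

/-- Multiplication by exp(-iθ) preserves |φ| and, along horizontal fields, replaces A by A' without
changing the modulus of the magnetic derivative. -/
theorem FormBound.of_gauge {A A' : OneForm} {B : Heis → Heis [⋀^Fin 2]→L[ℝ] ℝ}
    (h : IsVectorPotential A B) (h' : IsVectorPotential A' B) {m : ℝ} (hA : FormBound A m) :
    FormBound A' m := by
  obtain ⟨θ, hθ, hAA⟩ := h.exists_gauge h'
  intro φ
  have hexp : ContDiff ℝ ∞ fun p => Complex.exp (-(Complex.I * θ p)) :=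
    Complex.contDiff_exp.comp (contDiff_const.mul (Complex.ofRealCLM.contDiff.comp hθ)).neg
  have hn : ∀ q, ‖Complex.exp (-(Complex.I * θ q))‖ = 1 := by
    intro q
    rw [Complex.norm_exp]
    simp
  have key := hA (mkTest (fun p => Complex.exp (-(Complex.I * θ p)) * φ p)
    (hexp.mul φ.contDiff) φ.hasCompactSupport.mul_left)
  have hm : ∀ V : Heis → Heis, (∀ q, contactForm q (V q) = 0) → ∀ q,
      ‖magDeriv A V (fun p => Complex.exp (-(Complex.I * θ p)) * φ p) q‖ =
        ‖magDeriv A' V φ q‖ := by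
    intro V hV q
    rw [magDeriv_gauge ((hθ.differentiable (by simp)) q)
      ((φ.contDiff.differentiable (by simp)) q) (hAA q _ (hV q)), norm_mul, hn, one_mul]
  have e : ⇑(mkTest (fun p => Complex.exp (-(Complex.I * θ p)) * φ p)
    (hexp.mul φ.contDiff) φ.hasCompactSupport.mul_left) =
      fun p => Complex.exp (-(Complex.I * θ p)) * φ p := rfl
  rw [e] at key
  simpa only [hm _ contactForm_fieldX, hm _ contactForm_fieldY, norm_mul, hn, one_mul] using key

/-! ### Rotations and dilations -/

/-- The automorphism of `ℍ¹` that acts on the horizontal coordinates as multiplication by the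
complex number `α + iβ`. -/
def dilation (α β : ℝ) : Heis →L[ℝ] Heis :=
  (α • formDx - β • formDy).prod ((β • formDx + α • formDy).prod ((α ^ 2 + β ^ 2) • formDz))

@[simp] theorem dilation_apply (α β : ℝ) (q : Heis) :
    dilation α β q = (α * q.1 - β * q.2.1, β * q.1 + α * q.2.1, (α ^ 2 + β ^ 2) * q.2.2) := rfl

theorem dilation_comp_dilation {α β α' β' : ℝ} (h1 : α * α' - β * β' = 1)
    (h2 : α * β' + β * α' = 0) : (dilation α β).comp (dilation α' β') = .id ℝ Heis := by
  have h3 : (α ^ 2 + β ^ 2) * (α' ^ 2 + β' ^ 2) = 1 := by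
    -- The modulus of complex numbers is multiplicative.
    linear_combination (α * α' - β * β' + 1) * h1 + (α * β' + β * α') * h2
  refine ContinuousLinearMap.ext fun q => Prod.ext ?_ (Prod.ext ?_ ?_)
  · simp
    linear_combination q.1 * h1 - q.2.1 * h2
  · simp
    linear_combination q.2.1 * h1 + q.1 * h2
  · simp
    linear_combination q.2.2 * h3

theorem contactForm_dilation (α β : ℝ) (q v : Heis) :
    contactForm (dilation α β q) (dilation α β v) = (α ^ 2 + β ^ 2) * contactForm q v := by
  simp
  ring

theorem dilation_fieldX (α β : ℝ) (q : Heis) :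
    dilation α β (fieldX q) = α • fieldX (dilation α β q) + β • fieldY (dilation α β q) := by
  ext <;> simp [fieldX, fieldY]
  ring

theorem dilation_fieldY (α β : ℝ) (q : Heis) :
    dilation α β (fieldY q) = -β • fieldX (dilation α β q) + α • fieldY (dilation α β q) := by
  ext <;> simp [fieldX, fieldY]
  ring

theorem contDiff_pullback {C : Heis → Heis →L[ℝ] ℝ} (hC : ContDiff ℝ ∞ C) (T : Heis →L[ℝ] Heis) :
    ContDiff ℝ ∞ fun q => (C (T q)).comp T :=
  (hC.comp T.contDiff).clm_comp contDiff_const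

theorem extD_pullback {C : Heis → Heis →L[ℝ] ℝ} (hC : ContDiff ℝ ∞ C) (T : Heis →L[ℝ] Heis)
    (q v w : Heis) :
    extD (fun p => (C (T p)).comp T) q ![v, w] = extD C (T q) ![T v, T w] := by
  have hd : Differentiable ℝ C := hC.differentiable (by simp)
  have h1 : HasFDerivAt (fun p => (C (T p)).comp T)
      ((((ContinuousLinearMap.compL ℝ Heis Heis ℝ).flip T).comp (fderiv ℝ C (T q))).comp T) q :=
    (((ContinuousLinearMap.compL ℝ Heis Heis ℝ).flip T).hasFDerivAt.comp (T q)
      (hd (T q)).hasFDerivAt).comp q T.hasFDerivAt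
  rw [extD_apply h1.differentiableAt, extD_apply (hd _), h1.fderiv]
  rfl

/-- The pull-back of a `1`-form under a linear map. -/
def OneForm.pullback (A : OneForm) (T : Heis →L[ℝ] Heis) : OneForm :=
  ⟨fun q => (A.toFun (T q)).comp T, contDiff_pullback A.smooth T⟩

/-- With w = α + iβ and b = b₁ + i b₂, the new field is |w|² w̄ b: the factor |w|² comes from ω, and
w̄ b from the horizontal covectors. -/
theorem IsVectorPotential.pullback_dilation {A : OneForm} {b₁ b₂ : ℝ}
    (h : IsVectorPotential A (uniformField b₁ b₂)) (α β : ℝ) :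
    IsVectorPotential (A.pullback (dilation α β))
      (uniformField ((α ^ 2 + β ^ 2) * (α * b₁ + β * b₂))
        ((α ^ 2 + β ^ 2) * (α * b₂ - β * b₁))) := by
  obtain ⟨f, hf, hfB⟩ := h
  refine ⟨fun q => (α ^ 2 + β ^ 2) * f (dilation α β q),
    contDiff_const.mul (hf.comp (dilation α β).contDiff), fun q => ?_⟩
  have e : (fun p => (A.pullback (dilation α β)).toFun p +
      ((α ^ 2 + β ^ 2) * f (dilation α β p)) • contactForm p) =
      fun p => ((fun p => A.toFun p + f p • contactForm p) (dilation α β p)).comp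
        (dilation α β) := by
    funext p
    refine ContinuousLinearMap.ext fun v => ?_
    change A.toFun (dilation α β p) (dilation α β v) + (_ * f _) * contactForm p v =
      A.toFun (dilation α β p) (dilation α β v) +
        f _ * contactForm (dilation α β p) (dilation α β v)
    rw [contactForm_dilation]
    ring
  rw [e]
  refine twoForm_ext fun v w => ?_
  rw [extD_pullback (C := fun p => A.toFun p + f p • contactForm p)
    (A.smooth.add (hf.smul contDiff_contactForm)), hfB, uniformField_apply,
    uniformField_apply, contactForm_dilation, contactForm_dilation]
  simp only [dilation_apply]
  ring

theorem magDeriv_pullback (A : OneForm) {T : Heis →L[ℝ] Heis} {V X Y : Heis → Heis} {a b : ℝ}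
    {u : Heis → ℂ} {q : Heis} (hu : DifferentiableAt ℝ u (T q))
    (hV : T (V q) = a • X (T q) + b • Y (T q)) :
    magDeriv (A.pullback T) V (u ∘ T) q = a * magDeriv A X u (T q) + b * magDeriv A Y u (T q) := by
  have h1 := hu.hasFDerivAt.comp q T.hasFDerivAt
  unfold magDeriv
  rw [h1.fderiv]
  change fderiv ℝ u (T q) (T (V q)) + Complex.I * (A.toFun (T q) (T (V q)) : ℝ) * u (T q) = _
  rw [hV]
  simp
  ring

theorem sq_norm_rotate (a b : ℝ) (P R : ℂ) :
    ‖(a : ℂ) * P + b * R‖ ^ 2 + ‖((-b : ℝ) : ℂ) * P + a * R‖ ^ 2 =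
      (a ^ 2 + b ^ 2) * (‖P‖ ^ 2 + ‖R‖ ^ 2) := by
  simp only [Complex.sq_norm, Complex.normSq_apply, Complex.add_re, Complex.add_im, Complex.mul_re,
    Complex.mul_im, Complex.ofReal_re, Complex.ofReal_im]
  ring

/-- The images of X and Y under the dilation T are |w| times a rotated frame, so the energy density
at q is |w|² times that at T q. The Jacobian is common to both integrals and cancels, so its value
is irrelevant. -/
theorem FormBound.pullback_dilation {A : OneForm} {m : ℝ} (hA : FormBound A m) {α β : ℝ}
    (hs : 0 < α ^ 2 + β ^ 2) :
    FormBound (A.pullback (dilation α β)) ((α ^ 2 + β ^ 2) * m) := by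
  -- The inverse of T is the dilation by w⁻¹ = w̄ / |w|².
  set s := α ^ 2 + β ^ 2 with hs_def
  set T := dilation α β with hT
  set T' := dilation (α / s) (-β / s) with hT'
  have hTT : T.comp T' = .id ℝ Heis :=
    dilation_comp_dilation (by field_simp; rw [hs_def]; ring) (by field_simp; ring)
  have hTT' : T'.comp T = .id ℝ Heis :=
    dilation_comp_dilation (by field_simp; rw [hs_def]; ring) (by field_simp; ring)
  have hTT1 : ∀ q, T (T' q) = q := fun q => congrArg (fun L : Heis →L[ℝ] Heis => L q) hTT
  have hTT2 : ∀ q, T' (T q) = q := fun q => congrArg (fun L : Heis →L[ℝ] Heis => L q) hTT'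
  have hdet : LinearMap.det (T : Heis →ₗ[ℝ] Heis) ≠ 0 := by
    intro h0
    have h1 : LinearMap.det ((T : Heis →ₗ[ℝ] Heis) ∘ₗ (T' : Heis →ₗ[ℝ] Heis)) = 1 := by
      rw [← ContinuousLinearMap.toLinearMap_comp, hTT, ContinuousLinearMap.coe_id,
        LinearMap.det_id]
    rw [LinearMap.det_comp, h0, zero_mul] at h1
    exact zero_ne_one h1
  have : (volume : Measure Heis).IsAddHaarMeasure := Measure.prod.instIsAddHaarMeasure _ _
  have hmap : (volume : Measure Heis).map T =
      ENNReal.ofReal |(LinearMap.det (T : Heis →ₗ[ℝ] Heis))⁻¹| • volume :=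
    Measure.map_linearMap_addHaar_eq_smul_addHaar volume hdet
  have hint : ∀ F : Heis → ℝ, Continuous F →
      ∫ q, F (T q) = |(LinearMap.det (T : Heis →ₗ[ℝ] Heis))⁻¹| * ∫ q, F q := by
    intro F hF
    rw [← integral_map T.continuous.aemeasurable hF.aestronglyMeasurable, hmap,
      integral_smul_measure, ENNReal.toReal_ofReal (abs_nonneg _), smul_eq_mul]
  intro φ
  let ψ : Test := mkTest (φ ∘ T') (φ.contDiff.comp T'.contDiff)
    (φ.hasCompactSupport.comp_isClosedEmbedding
      (Homeomorph.mk ⟨T', T, hTT1, hTT2⟩ T'.continuous T.continuous).isClosedEmbedding)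
  have hφ : ⇑φ = ψ ∘ T := by
    funext q
    change φ q = φ (T' (T q))
    rw [hTT2]
  have hψ := hA ψ
  have hd : ∀ q, DifferentiableAt ℝ ψ q := fun q => (ψ.contDiff.differentiable (by simp)) q
  rw [hφ]
  simp only [Function.comp_def]
  -- Only the function argument of `magDeriv` is folded back to ψ ∘ T; the pointwise values stay as
  -- ψ (T q).
  simp only [← Function.comp_def (f := ψ)]
  have hX : ∀ q, magDeriv (A.pullback T) fieldX (ψ ∘ T) q =
      α * magDeriv A fieldX ψ (T q) + β * magDeriv A fieldY ψ (T q) := fun q =>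
    magDeriv_pullback A (hd _) (dilation_fieldX α β q)
  have hY : ∀ q, magDeriv (A.pullback T) fieldY (ψ ∘ T) q =
      (-β : ℝ) * magDeriv A fieldX ψ (T q) + α * magDeriv A fieldY ψ (T q) := fun q =>
    magDeriv_pullback A (hd _) (dilation_fieldY α β q)
  simp only [hX, hY, sq_norm_rotate, ← hs_def]
  rw [integral_const_mul, hint (fun q => ‖ψ q‖ ^ 2) (ψ.continuous.norm.pow 2),
    hint (fun q => ‖magDeriv A fieldX ψ q‖ ^ 2 + ‖magDeriv A fieldY ψ q‖ ^ 2)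
      (((continuous_magDeriv A continuous_fieldX ψ).norm.pow 2).add
        ((continuous_magDeriv A continuous_fieldY ψ).norm.pow 2))]
  calc s * m * (|(LinearMap.det (T : Heis →ₗ[ℝ] Heis))⁻¹| * ∫ q, ‖ψ q‖ ^ 2)
      = s * (|(LinearMap.det (T : Heis →ₗ[ℝ] Heis))⁻¹| * (m * ∫ q, ‖ψ q‖ ^ 2)) := by ring
    _ ≤ _ := by gcongr

/-- Form bounds scale under a rotation and dilation of the field. -/
theorem FormBound.scale {A A' : OneForm} {b₁ b₂ b₁' b₂' α β m : ℝ} (hA : FormBound A m)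
    (h : IsVectorPotential A (uniformField b₁ b₂))
    (h' : IsVectorPotential A' (uniformField b₁' b₂')) (hs : 0 < α ^ 2 + β ^ 2)
    (h1 : b₁' = (α ^ 2 + β ^ 2) * (α * b₁ + β * b₂))
    (h2 : b₂' = (α ^ 2 + β ^ 2) * (α * b₂ - β * b₁)) :
    FormBound A' ((α ^ 2 + β ^ 2) * m) := by
  subst h1 h2
  exact (hA.pullback_dilation hs).of_gauge (h.pullback_dilation α β) h'

/-! ### Transport along flows -/

theorem eLpNorm_two_sq (f : Heis → ℂ) :
    eLpNorm f 2 volume ^ (2 : ℝ) = ∫⁻ q, ‖f q‖ₑ ^ (2 : ℝ) := by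
  simpa using eLpNorm_nnreal_pow_eq_lintegral (f := f) (μ := (volume : Measure Heis))
    (p := 2) two_ne_zero

/-- The displacement of a function under a volume-preserving motion with phase is bounded by its
speed. -/
theorem eLpNorm_displacement_le {F : ℝ → Heis → Heis} (hF : Continuous fun p : ℝ × Heis => F p.1 p.2)
    (hmp : ∀ s, MeasurePreserving (F s)) {w : Heis → ℂ} (hw : Continuous w)
    {G G' : ℝ → Heis → ℂ} (hG : ∀ q s, HasDerivAt (fun s => G s q) (G' s q) s)
    (hc : ∀ q, Continuous fun s => G' s q) (hn : ∀ s q, ‖G' s q‖ = ‖w (F s q)‖) :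
    eLpNorm (G 1 - G 0) 2 volume ≤ eLpNorm w 2 volume := by
  -- On a probability space the L¹ norm is at most the L² norm; this bounds the displacement ∫ G' ds
  -- pointwise. Tonelli and invariance of the volume then finish.
  have : IsProbabilityMeasure ((volume : Measure ℝ).restrict (Set.Ioc 0 1)) := ⟨by simp⟩
  have hpt : ∀ q, ‖(G 1 - G 0) q‖ₑ ^ (2 : ℝ) ≤
      ∫⁻ s in Set.Ioc (0 : ℝ) 1, ‖w (F s q)‖ₑ ^ (2 : ℝ) := by
    intro q
    have h1 : (G 1 - G 0) q = ∫ s in Set.Ioc (0 : ℝ) 1, G' s q := by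
      rw [← intervalIntegral.integral_of_le zero_le_one, Pi.sub_apply]
      exact (intervalIntegral.integral_eq_sub_of_hasDerivAt (fun s _ => hG q s)
        ((hc q).intervalIntegrable _ _)).symm
    have h2 : ‖(G 1 - G 0) q‖ₑ ≤
        eLpNorm (fun s => G' s q) 2 ((volume : Measure ℝ).restrict (Set.Ioc 0 1)) := by
      rw [h1]
      refine (enorm_integral_le_lintegral_enorm _).trans ?_
      rw [← eLpNorm_one_eq_lintegral_enorm]
      exact eLpNorm_le_eLpNorm_of_exponent_le one_le_two (hc q).aestronglyMeasurable
    refine (ENNReal.rpow_le_rpow h2 zero_le_two).trans_eq ?_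
    have h3 := eLpNorm_nnreal_pow_eq_lintegral (f := fun s => G' s q)
      (μ := (volume : Measure ℝ).restrict (Set.Ioc 0 1)) (p := 2) two_ne_zero
    have h4 : ∀ s, ‖G' s q‖ₑ = ‖w (F s q)‖ₑ := fun s => by
      rw [← ofReal_norm, hn, ofReal_norm]
    simpa [h4] using h3
  have hmeas : Measurable fun p : Heis × ℝ => ‖w (F p.2 p.1)‖ₑ ^ (2 : ℝ) :=
    ((hw.comp (hF.comp (continuous_snd.prodMk continuous_fst))).enorm.measurable).pow_const _
  rw [← ENNReal.rpow_le_rpow_iff (z := 2) (by norm_num), eLpNorm_two_sq, eLpNorm_two_sq]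
  calc ∫⁻ q, ‖(G 1 - G 0) q‖ₑ ^ (2 : ℝ)
      ≤ ∫⁻ q, ∫⁻ s in Set.Ioc (0 : ℝ) 1, ‖w (F s q)‖ₑ ^ (2 : ℝ) := lintegral_mono hpt
    _ = ∫⁻ s in Set.Ioc (0 : ℝ) 1, ∫⁻ q, ‖w (F s q)‖ₑ ^ (2 : ℝ) :=
        lintegral_lintegral_swap hmeas.aemeasurable
    _ = ∫⁻ _ in Set.Ioc (0 : ℝ) 1, ∫⁻ q, ‖w q‖ₑ ^ (2 : ℝ) := by
        refine lintegral_congr fun s => ?_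
        exact (hmp s).lintegral_comp (f := fun q => ‖w q‖ₑ ^ (2 : ℝ))
          (hw.enorm.measurable.pow_const _)
    _ = ∫⁻ q, ‖w q‖ₑ ^ (2 : ℝ) := by simp

/-- The flow of the vector field `X`. -/
def flowX (t : ℝ) (q : Heis) : Heis := (q.1 + t, q.2.1, q.2.2 - t * q.2.1 / 2)

/-- The flow of the vector field `Y`. -/
def flowY (t : ℝ) (q : Heis) : Heis := (q.1, q.2.1 + t, q.2.2 + t * q.1 / 2)

theorem continuous_flowX : Continuous fun p : ℝ × Heis => flowX p.1 p.2 := by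
  unfold flowX
  fun_prop

theorem continuous_flowY : Continuous fun p : ℝ × Heis => flowY p.1 p.2 := by
  unfold flowY
  fun_prop

theorem measurePreserving_flowX (t : ℝ) : MeasurePreserving (flowX t) := by
  have h1 : MeasurePreserving (fun p : ℝ × ℝ => (p.1, p.2 - t * p.1 / 2)) :=
    (MeasurePreserving.id volume).skew_product (g := fun y z => z - t * y / 2)
      (by fun_prop) (Eventually.of_forall fun y => by
        simpa only [sub_eq_add_neg] using (measurePreserving_add_right volume (-(t * y / 2))).map_eq)
  exact (measurePreserving_add_right volume t).prod h1

theorem measurePreserving_flowY (t : ℝ) : MeasurePreserving (flowY t) :=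
  (MeasurePreserving.id (volume : Measure ℝ)).skew_product
    (g := fun x (p : ℝ × ℝ) => (p.1 + t, p.2 + t * x / 2)) (by fun_prop)
    (Eventually.of_forall fun x => ((measurePreserving_add_right volume t).prod
      (measurePreserving_add_right volume (t * x / 2))).map_eq)

theorem hasDerivAt_flowX (q : Heis) (t : ℝ) :
    HasDerivAt (fun s => flowX s q) (fieldX (flowX t q)) t := by
  have h1 : HasDerivAt (fun s : ℝ => q.1 + s) 1 t := (hasDerivAt_id t).const_add _
  have h2 : HasDerivAt (fun s : ℝ => q.2.2 - s * q.2.1 / 2) (-(1 * q.2.1 / 2)) t :=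
    (((hasDerivAt_id t).mul_const q.2.1).div_const 2).const_sub _
  have h3 : fieldX (flowX t q) = (1, 0, -(1 * q.2.1 / 2)) := by
    simp [fieldX, flowX, neg_div]
  rw [h3]
  exact h1.prodMk ((hasDerivAt_const t q.2.1).prodMk h2)

theorem hasDerivAt_flowY (q : Heis) (t : ℝ) :
    HasDerivAt (fun s => flowY s q) (fieldY (flowY t q)) t := by
  have h1 : HasDerivAt (fun s : ℝ => q.2.1 + s) 1 t := (hasDerivAt_id t).const_add _
  have h2 : HasDerivAt (fun s : ℝ => q.2.2 + s * q.1 / 2) (1 * q.1 / 2) t :=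
    (((hasDerivAt_id t).mul_const q.1).div_const 2).const_add _
  have h3 : fieldY (flowY t q) = (0, 1, 1 * q.1 / 2) := by
    simp [fieldY, flowY]
  rw [h3]
  exact (hasDerivAt_const t q.1).prodMk (h1.prodMk h2)

/-! ### Positivity of the form for the field `dx ∧ ω` -/

/-- The vector potential `(x² / 2) dy` of `dx ∧ ω` modulo `ω`. -/
def modelPotential : OneForm where
  toFun q := (q.1 ^ 2 / 2) • formDy
  smooth := by fun_prop

theorem modelPotential_isVectorPotential :
    IsVectorPotential modelPotential (uniformField 1 0) := by
  -- Since dω = -dx ∧ dy, the term x dω in d(x ω) cancels d((x²/2) dy) = x dx ∧ dy and leaves dx ∧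
  -- ω.
  refine ⟨fun q => q.1, contDiff_fst, fun q => twoForm_ext fun v w => ?_⟩
  have h1 : HasFDerivAt (fun p : Heis => p.1) formDx q := formDx.hasFDerivAt
  have h2 : HasFDerivAt (fun p : Heis => p.2.1) formDy q := formDy.hasFDerivAt
  have h3 : HasFDerivAt contactForm _ q :=
    (((h1.smul_const formDy).fun_sub (h2.smul_const formDx)).const_smul (1 / 2 : ℝ)).const_sub
      formDz
  have h4 : HasFDerivAt (fun p : Heis => modelPotential.toFun p + p.1 • contactForm p) _ q :=
    (((h1.fun_mul h1).mul_const (1 / 2 : ℝ)).congr_of_eventuallyEq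
      (f₁ := fun p : Heis => p.1 ^ 2 / 2) (Eventually.of_forall fun p => by
        dsimp only
        ring)).smul_const formDy |>.fun_add (h1.fun_smul h3)
  rw [extD_apply h4.differentiableAt, h4.fderiv, uniformField_apply]
  simp
  ring

/-- Translation along `X`. -/
def transX (t : ℝ) (u : Heis → ℂ) (q : Heis) : ℂ := u (flowX t q)

/-- Magnetic translation along `Y`. -/
def transY (t : ℝ) (u : Heis → ℂ) (q : Heis) : ℂ :=
  Complex.exp (((t * (q.1 ^ 2 / 2) : ℝ) : ℂ) * Complex.I) * u (flowY t q)

theorem continuous_transX (t : ℝ) {u : Heis → ℂ} (hu : Continuous u) :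
    Continuous (transX t u) :=
  hu.comp (continuous_flowX.comp (continuous_const.prodMk continuous_id))

theorem continuous_transY (t : ℝ) {u : Heis → ℂ} (hu : Continuous u) :
    Continuous (transY t u) := by
  have h : Continuous fun q : Heis => Complex.exp (((t * (q.1 ^ 2 / 2) : ℝ) : ℂ) * Complex.I) := by
    fun_prop
  exact h.mul (hu.comp (continuous_flowY.comp (continuous_const.prodMk continuous_id)))

theorem eLpNorm_transX (t : ℝ) {u : Heis → ℂ} (hu : Continuous u) :
    eLpNorm (transX t u) 2 volume = eLpNorm u 2 volume :=
  eLpNorm_comp_measurePreserving hu.aestronglyMeasurable (measurePreserving_flowX t)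

theorem eLpNorm_transY (t : ℝ) {u : Heis → ℂ} (hu : Continuous u) :
    eLpNorm (transY t u) 2 volume = eLpNorm u 2 volume := by
  rw [← eLpNorm_comp_measurePreserving hu.aestronglyMeasurable (measurePreserving_flowY t)]
  refine eLpNorm_congr_norm_ae (Eventually.of_forall fun q => ?_)
  rw [transY, norm_mul, Complex.norm_exp_ofReal_mul_I, one_mul]
  rfl

/-- A telescoping step: as the translation is an isometry, displacements of successive factors of a
product simply add up. -/
theorem eLpNorm_transX_sub_le (t : ℝ) {u v : Heis → ℂ} (hu : Continuous u) (hv : Continuous v) :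
    eLpNorm (transX t u - v) 2 volume ≤
      eLpNorm (u - v) 2 volume + eLpNorm (transX t v - v) 2 volume := by
  have h : transX t u - v = transX t (u - v) + (transX t v - v) := by
    ext q
    simp [transX]
  rw [h, ← eLpNorm_transX t (hu.sub hv)]
  exact eLpNorm_add_le (continuous_transX t (hu.sub hv)).aestronglyMeasurable
    ((continuous_transX t hv).sub hv).aestronglyMeasurable one_le_two

theorem eLpNorm_transY_sub_le (t : ℝ) {u v : Heis → ℂ} (hu : Continuous u) (hv : Continuous v) :
    eLpNorm (transY t u - v) 2 volume ≤
      eLpNorm (u - v) 2 volume + eLpNorm (transY t v - v) 2 volume := by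
  have h : transY t u - v = transY t (u - v) + (transY t v - v) := by
    ext q
    simp [transY, mul_sub]
  rw [h, ← eLpNorm_transY t (hu.sub hv)]
  exact eLpNorm_add_le (continuous_transY t (hu.sub hv)).aestronglyMeasurable
    ((continuous_transY t hv).sub hv).aestronglyMeasurable one_le_two

theorem eLpNorm_transX_one_sub_le (φ : Test) :
    eLpNorm (transX 1 φ - ⇑φ) 2 volume ≤ eLpNorm (magDeriv modelPotential fieldX φ) 2 volume := by
  have hφ : Differentiable ℝ φ := φ.contDiff.differentiable (by simp)
  have hm : ∀ q, magDeriv modelPotential fieldX φ q = fderiv ℝ φ q (fieldX q) := by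
    intro q
    simp [magDeriv, modelPotential, fieldX]
  have hc := continuous_magDeriv modelPotential continuous_fieldX φ
  have h0 : (φ : Heis → ℂ) = transX 0 φ := by
    ext q
    simp [transX, flowX]
  have := eLpNorm_displacement_le continuous_flowX measurePreserving_flowX hc
    (G := fun s => transX s φ) (G' := fun s q => magDeriv modelPotential fieldX φ (flowX s q))
    (fun q s => by
      rw [hm]
      exact (hφ _).hasFDerivAt.comp_hasDerivAt s (hasDerivAt_flowX q s))
    (fun q => hc.comp (continuous_flowX.comp (continuous_id.prodMk continuous_const)))
    (fun s q => rfl)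
  rwa [← h0] at this

theorem eLpNorm_transX_neg_one_sub_le (φ : Test) :
    eLpNorm (transX (-1) φ - ⇑φ) 2 volume ≤
      eLpNorm (magDeriv modelPotential fieldX φ) 2 volume := by
  -- An isometry and its inverse displace φ equally far.
  have h : transX (-1) φ - ⇑φ = transX (-1) (⇑φ - transX 1 φ) := by
    ext q
    simp [transX, flowX, sub_sub, ← add_div]
  rw [h, eLpNorm_transX _ (φ.continuous.sub (continuous_transX 1 φ.continuous)), eLpNorm_sub_comm]
  exact eLpNorm_transX_one_sub_le φ

theorem eLpNorm_transY_one_sub_le (φ : Test) :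
    eLpNorm (transY 1 φ - ⇑φ) 2 volume ≤ eLpNorm (magDeriv modelPotential fieldY φ) 2 volume := by
  have hφ : Differentiable ℝ φ := φ.contDiff.differentiable (by simp)
  have hc := continuous_magDeriv modelPotential continuous_fieldY φ
  have h0 : (φ : Heis → ℂ) = transY 0 φ := by
    ext q
    simp [transY, flowY]
  have := eLpNorm_displacement_le continuous_flowY measurePreserving_flowY hc
    (G := fun s => transY s φ)
    (G' := fun s q => Complex.exp (((s * (q.1 ^ 2 / 2) : ℝ) : ℂ) * Complex.I) *
      magDeriv modelPotential fieldY φ (flowY s q))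
    (fun q s => by
      have h1 : HasDerivAt (fun s : ℝ => ((s * (q.1 ^ 2 / 2) : ℝ) : ℂ))
          ((1 * (q.1 ^ 2 / 2) : ℝ) : ℂ) s := ((hasDerivAt_id s).mul_const _).ofReal_comp
      have h2 := (h1.mul_const Complex.I).cexp.fun_mul
        ((hφ _).hasFDerivAt.comp_hasDerivAt s (hasDerivAt_flowY q s))
      refine h2.congr_deriv ?_
      simp [magDeriv, modelPotential, fieldY, flowY]
      ring)
    (fun q => (by fun_prop : Continuous fun s : ℝ =>
        Complex.exp (((s * (q.1 ^ 2 / 2) : ℝ) : ℂ) * Complex.I)).mul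
      (hc.comp (continuous_flowY.comp (continuous_id.prodMk continuous_const))))
    (fun s q => by rw [norm_mul, Complex.norm_exp_ofReal_mul_I, one_mul])
  rwa [← h0] at this

/-- The iterated group commutator of the magnetic translations is a scalar. -/
theorem transX_transY_commutator (u : Heis → ℂ) :
    transX 1 (transY 1 (transX (-1) (transX (-1) (transY 1 (transX 1 u))))) =
      Complex.exp Complex.I • transY 1 (transY 1 u) := by
  ext q
  -- The central shifts cancel. The phases do not: the two Y-translations start at x + 1 and x - 1,
  -- and (x + 1)²/2 + (x - 1)²/2 exceeds x² by 1.
  have h1 : flowX 1 (flowY 1 (flowX (-1) (flowX (-1) (flowY 1 (flowX 1 q))))) =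
      flowY 1 (flowY 1 q) := by
    ext <;> simp only [flowX, flowY] <;> ring
  simp only [transX, transY, Pi.smul_apply, smul_eq_mul, h1, ← mul_assoc, ← Complex.exp_add]
  congr 2
  simp [flowX, flowY]
  ring

theorem norm_exp_I_sub_one_pos : 0 < ‖Complex.exp Complex.I - 1‖ := by
  rw [norm_pos_iff, sub_ne_zero]
  intro h
  have h1 := congrArg Complex.im h
  rw [Complex.exp_im] at h1
  simp only [Complex.I_re, Complex.I_im, Real.exp_zero, one_mul, Complex.one_im] at h1
  exact (Real.sin_pos_of_pos_of_lt_pi one_pos (by linarith [Real.pi_gt_three])).ne' h1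

/-- The two products in the commutator identity displace φ by at most 4a + 2r (four X-factors, two
Y-factors) and 2r, where a and r are the norms of the magnetic derivatives; they differ by exp(i) -
1 times an isometric image of φ. -/
theorem eLpNorm_le_magDeriv (φ : Test) :
    ‖Complex.exp Complex.I - 1‖ₑ * eLpNorm φ 2 volume ≤
      4 * eLpNorm (magDeriv modelPotential fieldX φ) 2 volume +
        4 * eLpNorm (magDeriv modelPotential fieldY φ) 2 volume := by
  set a := eLpNorm (magDeriv modelPotential fieldX φ) 2 volume
  set r := eLpNorm (magDeriv modelPotential fieldY φ) 2 volume
  have hφ : Continuous φ := φ.continuous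
  have c1 := continuous_transX 1 hφ
  have c2 := continuous_transY 1 c1
  have c3 := continuous_transX (-1) c2
  have c4 := continuous_transX (-1) c3
  have c5 := continuous_transY 1 c4
  have c6 := continuous_transX 1 c5
  have d1 := continuous_transY 1 hφ
  have d2 := continuous_transY 1 d1
  have hX := eLpNorm_transX_one_sub_le φ
  have hX' := eLpNorm_transX_neg_one_sub_le φ
  have hY := eLpNorm_transY_one_sub_le φ
  have hw : eLpNorm (transX 1 (transY 1 (transX (-1) (transX (-1) (transY 1 (transX 1 φ))))) - ⇑φ)
      2 volume ≤ ((((a + r) + a) + a) + r) + a :=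
    (eLpNorm_transX_sub_le 1 c5 hφ).trans <| add_le_add
      ((eLpNorm_transY_sub_le 1 c4 hφ).trans <| add_le_add
      ((eLpNorm_transX_sub_le (-1) c3 hφ).trans <| add_le_add
      ((eLpNorm_transX_sub_le (-1) c2 hφ).trans <| add_le_add
      ((eLpNorm_transY_sub_le 1 c1 hφ).trans <| add_le_add hX hY) hX') hX') hY) hX
  have hv : eLpNorm (transY 1 (transY 1 φ) - ⇑φ) 2 volume ≤ r + r :=
    (eLpNorm_transY_sub_le 1 d1 hφ).trans <| add_le_add hY hY
  have hs : (Complex.exp Complex.I - 1) • transY 1 (transY 1 φ) =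
      (transX 1 (transY 1 (transX (-1) (transX (-1) (transY 1 (transX 1 φ))))) - ⇑φ) -
        (transY 1 (transY 1 φ) - ⇑φ) := by
    rw [transX_transY_commutator, sub_smul, one_smul]
    abel
  calc ‖Complex.exp Complex.I - 1‖ₑ * eLpNorm φ 2 volume
      = eLpNorm ((Complex.exp Complex.I - 1) • transY 1 (transY 1 φ)) 2 volume := by
        rw [eLpNorm_const_smul, eLpNorm_transY 1 d1, eLpNorm_transY 1 hφ]
    _ ≤ (((((a + r) + a) + a) + r) + a) + (r + r) := by
        rw [hs]
        exact (eLpNorm_sub_le (c6.sub hφ).aestronglyMeasurable (d2.sub hφ).aestronglyMeasurable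
          one_le_two).trans (add_le_add hw hv)
    _ = 4 * a + 4 * r := by ring

theorem integral_norm_sq_eq {f : Heis → ℂ} (hf : MemLp f 2 volume) :
    ∫ q, ‖f q‖ ^ 2 = (eLpNorm f 2 volume).toReal ^ 2 := by
  rw [← norm_toLp_sq hf, Lp.norm_toLp]

/-- The constant 32 comes from (4a + 4r)² ≤ 32 (a² + r²). -/
theorem modelPotential_formBound :
    FormBound modelPotential (‖Complex.exp Complex.I - 1‖ ^ 2 / 32) := by
  intro φ
  have hX := memLp_magDeriv modelPotential continuous_fieldX φ
  have hY := memLp_magDeriv modelPotential continuous_fieldY φ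
  rw [integral_add (hX.integrable_norm_pow two_ne_zero) (hY.integrable_norm_pow two_ne_zero),
    integral_norm_sq_eq hX, integral_norm_sq_eq hY, integral_norm_sq_eq (test_memLp φ)]
  have h := ENNReal.toReal_mono
    (ENNReal.add_ne_top.2 ⟨ENNReal.mul_ne_top (by simp) hX.2.ne, ENNReal.mul_ne_top (by simp) hY.2.ne⟩)
    (eLpNorm_le_magDeriv φ)
  rw [ENNReal.toReal_add (ENNReal.mul_ne_top (by simp) hX.2.ne)
    (ENNReal.mul_ne_top (by simp) hY.2.ne), ENNReal.toReal_mul, ENNReal.toReal_mul,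
    ENNReal.toReal_mul, toReal_enorm] at h
  simp only [ENNReal.toReal_ofNat] at h
  set a := (eLpNorm (magDeriv modelPotential fieldX φ) 2 volume).toReal
  set r := (eLpNorm (magDeriv modelPotential fieldY φ) 2 volume).toReal
  have h2 := pow_le_pow_left₀ (by positivity) h 2
  nlinarith [sq_nonneg (a - r)]

theorem formBottom_modelPotential_pos : 0 < formBottom modelPotential :=
  lt_of_lt_of_le (by have := norm_exp_I_sub_one_pos; positivity)
    ((formBottom_isGreatest modelPotential).2 modelPotential_formBound)

/-! ### The bottom of the form for a uniform field -/

theorem formBottom_eq {A : OneForm} {b₁ b₂ : ℝ}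
    (h : IsVectorPotential A (uniformField b₁ b₂)) :
    formBottom A =
      formBottom modelPotential * Real.sqrt (b₁ ^ 2 + b₂ ^ 2) ^ (2 / 3 : ℝ) := by
  have hA := formBottom_isGreatest A
  have hm := formBottom_isGreatest modelPotential
  by_cases hb : b₁ ^ 2 + b₂ ^ 2 = 0
  · obtain ⟨rfl, rfl⟩ : b₁ = 0 ∧ b₂ = 0 :=
      ⟨by nlinarith [sq_nonneg b₁, sq_nonneg b₂], by nlinarith [sq_nonneg b₁, sq_nonneg b₂]⟩
    -- The zero field is invariant under dilation by 2, so its bottom m satisfies 4m ≤ m, hence m ≤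
    -- 0.
    have h1 := hA.2 (hA.1.scale h h (α := 2) (β := 0) (by norm_num) (by norm_num) (by norm_num))
    have h2 : 0 ≤ formBottom A := hA.2 fun φ => by
      rw [zero_mul]
      positivity
    rw [hb, Real.sqrt_zero, Real.zero_rpow (by norm_num), mul_zero]
    linarith
  · have hb0 : 0 < b₁ ^ 2 + b₂ ^ 2 := lt_of_le_of_ne (by positivity) (Ne.symm hb)
    -- With s = |B|^(2/3), so s³ = |B|², the complex factor (b₁ - i b₂)/s has squared modulus s and
    -- carries the field (1, 0) to (b₁, b₂). Its inverse (b₁ + i b₂)/s² carries it back; the two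
    -- give opposite inequalities.
    set s := Real.sqrt (b₁ ^ 2 + b₂ ^ 2) ^ (2 / 3 : ℝ) with hs
    have hs0 : 0 < s := Real.rpow_pos_of_pos (Real.sqrt_pos.2 hb0) _
    have hs3 : s ^ 3 = b₁ ^ 2 + b₂ ^ 2 := by
      rw [hs, ← Real.rpow_natCast, ← Real.rpow_mul (Real.sqrt_nonneg _)]
      norm_num
      exact Real.sq_sqrt hb0.le
    have e1 : (b₁ / s) ^ 2 + (-b₂ / s) ^ 2 = s := by
      field_simp
      linarith
    have e2 : (b₁ / s ^ 2) ^ 2 + (b₂ / s ^ 2) ^ 2 = s⁻¹ := by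
      field_simp
      linarith
    have h1 := hA.2 (hm.1.scale modelPotential_isVectorPotential h (α := b₁ / s) (β := -b₂ / s)
      (by rw [e1]; exact hs0) (by rw [e1]; field_simp; ring) (by rw [e1]; field_simp; ring))
    have h2 := hm.2 (hA.1.scale h modelPotential_isVectorPotential (α := b₁ / s ^ 2)
      (β := b₂ / s ^ 2) (by rw [e2]; positivity) (by rw [e2]; field_simp; linarith)
      (by rw [e2]; ring))
    rw [e1] at h1
    rw [e2, inv_mul_le_iff₀ hs0] at h2
    linarith

end HeisenbergMagnetic

end

theorem theorem2p1 :
    ∃ c : ℝ, 0 < c ∧ ∀ (b₁ b₂ : ℝ) (A : HeisenbergMagnetic.OneForm),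
      HeisenbergMagnetic.IsVectorPotential A (HeisenbergMagnetic.uniformField b₁ b₂) →
        HeisenbergMagnetic.spectrumOf (HeisenbergMagnetic.magLaplacian A) ⊆
          Set.range Complex.ofReal ∧
        IsGLB {s : ℝ | (s : ℂ) ∈
            HeisenbergMagnetic.spectrumOf (HeisenbergMagnetic.magLaplacian A)}
          (c * Real.sqrt (b₁ ^ 2 + b₂ ^ 2) ^ (2 / 3 : ℝ)) := by
  refine ⟨_, HeisenbergMagnetic.formBottom_modelPotential_pos, fun b₁ b₂ A h => ?_⟩
  rw [← HeisenbergMagnetic.formBottom_eq h]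
  exact (HeisenbergMagnetic.spectrumOf_magLaplacian A).imp_right IsLeast.isGLB
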